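/- Let $K$ be an arbitrary (commutative) field, of any characteristic and cardinality. Let $A_4(K)$ be the $6$-dimensional $K$-vector space of alternating $4\times 4$ matrices over $K$ (those with $M^T=-M$ and zero diagonal), and let $\mathrm{Pf}$ be the hyperbolic quadratic form on $A_4(K)$ given by the pfaffian, $\mathrm{Pf}(M)=m_{12}m_{34}-m_{13}m_{24}+m_{14}m_{23}$ for $M=(m_{ij})$. Definitions. Let $(E,q)$ be an even-dimensional regular quadratic space over $K$. - A similarity of $(E,q)$ is a linear automorphism $s$ of $E$ for which there is $c\in K\setminus\{0\}$ with $q(s(x))=c\,q(x)$ for all $x\in E$. - A positive isometry of $(E,q)$ is a linear automorphism $v$ of $E$ with $q(v(x))=q(x)$ for all $x\in E$ such that $\det v=1$ if $\operatorname{char} K\neq 2$, and such that the Dickson invariant $\operatorname{rank}(v-\mathrm{id})\bmod 2$ of $v$ is zero if $\operatorname{char} K=2$. - Let $\overline K$ be an algebraic closure of $K$ and $q_{\overline K}$ the quadratic form on $\overline K\otimes_K E$ extending $q$. A positive similarity of $(E,q)$ is a similarity $s$ of $(E,q)$ whose $\overline K$-linear extension to $\overline K\otimes_K E$ has the form $\mu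 v$ with $\mu\in\overline K\setminus\{0\}$ and $v$ a positive isometry of $(\overline K\otimes_K E,\,q_{\overline K})$. Theorem. The positive similarities of $(A_4(K),\mathrm{Pf})$ form a group $\mathrm{GO}^+(\mathrm{Pf})$ under composition, and this group is exactly the set of all maps $$A_4(K)\to A_4(K),\qquad M\mapsto \lambda\,P M P^T,\qquad\text{with }\lambda\in K\setminus\{0\}\text{ and }P\in \mathrm{GL}_4(K).$$ -/

import Mathlib

open scoped TensorProduct Matrix

noncomputable section

namespace PfaffianSimilarity

section General

universe u v

/-- The quadratic form `Q_L` on `L ⊗ V` obtained from a quadratic form `Q` on the `K`-vector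
space `V` by extending scalars to `L`, in every characteristic (Mathlib's
`QuadraticForm.baseChange` needs `2` to be invertible). It is computed from any bilinear form
`B` such that `Q x = B x x`; by `eq_extendScalars` it does not depend on that choice and is
the unique quadratic form on `L ⊗ V` such that `Q_L (1 ⊗ x) = Q x`. -/
def extendScalars {K : Type u} [Field K] {V : Type v} [AddCommGroup V] [Module K V]
    (L : Type u) [Field L] [Algebra K L] (Q : QuadraticForm K V) : QuadraticForm L (L ⊗[K] V) :=
  LinearMap.BilinMap.toQuadraticMap
    (LinearMap.BilinForm.baseChange L
      (Classical.choose (LinearMap.BilinMap.toQuadraticMap_surjective Q)))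

theorem extendScalars_tmul {K : Type u} [Field K] {V : Type v} [AddCommGroup V] [Module K V]
    (L : Type u) [Field L] [Algebra K L] (Q : QuadraticForm K V) (a : L) (x : V) :
    extendScalars L Q (a ⊗ₜ[K] x) = a * a * algebraMap K L (Q x) := by
  have h := Classical.choose_spec (LinearMap.BilinMap.toQuadraticMap_surjective Q)
  have hx := congrArg (fun q : QuadraticForm K V => q x) h
  simp only [LinearMap.BilinMap.toQuadraticMap_apply] at hx
  rw [extendScalars, LinearMap.BilinMap.toQuadraticMap_apply,
    LinearMap.BilinForm.baseChange_tmul, hx, Algebra.smul_def, mul_comm]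

theorem eq_extendScalars {K : Type u} [Field K] {V : Type v} [AddCommGroup V] [Module K V]
    (L : Type u) [Field L] [Algebra K L] (Q : QuadraticForm K V) (R : QuadraticForm L (L ⊗[K] V))
    (hR : ∀ x : V, R (1 ⊗ₜ[K] x) = algebraMap K L (Q x)) : R = extendScalars L Q := by
  set S := extendScalars L Q with hS
  have hS' : ∀ x : V, S (1 ⊗ₜ[K] x) = algebraMap K L (Q x) := fun x => by
    rw [hS, extendScalars_tmul]; simp
  have h1 : ∀ (a : L) (x : V), R (a ⊗ₜ[K] x) = S (a ⊗ₜ[K] x) := by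
    intro a x
    have : a ⊗ₜ[K] x = a • ((1 : L) ⊗ₜ[K] x) := by simp [TensorProduct.smul_tmul']
    rw [this, QuadraticMap.map_smul, QuadraticMap.map_smul, hR, hS']
  have h2 : ∀ (a b : L) (x y : V), QuadraticMap.polar R (a ⊗ₜ[K] x) (b ⊗ₜ[K] y) =
      QuadraticMap.polar S (a ⊗ₜ[K] x) (b ⊗ₜ[K] y) := by
    intro a b x y
    have hx : a ⊗ₜ[K] x = a • ((1 : L) ⊗ₜ[K] x) := by simp [TensorProduct.smul_tmul']
    have hy : b ⊗ₜ[K] y = b • ((1 : L) ⊗ₜ[K] y) := by simp [TensorProduct.smul_tmul']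
    rw [hx, hy, QuadraticMap.polar_smul_left, QuadraticMap.polar_smul_left,
      QuadraticMap.polar_smul_right, QuadraticMap.polar_smul_right]
    simp only [QuadraticMap.polar, ← TensorProduct.tmul_add, hR, hS']
  have h3 : ∀ z w : L ⊗[K] V, QuadraticMap.polar R z w = QuadraticMap.polar S z w := by
    intro z w
    induction z with
    | zero => simp
    | add z₁ z₂ h₁ h₂ => rw [QuadraticMap.polar_add_left, QuadraticMap.polar_add_left, h₁, h₂]
    | tmul a x =>
      induction w with
      | zero => simp
      | add w₁ w₂ h₁ h₂ => rw [QuadraticMap.polar_add_right, QuadraticMap.polar_add_right, h₁, h₂]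
      | tmul b y => exact h2 a b x y
  refine QuadraticMap.ext fun z => ?_
  induction z with
  | zero => simp
  | add z w hz hw => rw [QuadraticMap.map_add R, QuadraticMap.map_add S, hz, hw, h3]
  | tmul a x => exact h1 a x

/-- `s` is a similarity of the quadratic space `(V, Q)` onto itself. -/
def IsSimilarity {K : Type u} [Field K] {V : Type v} [AddCommGroup V] [Module K V]
    (Q : QuadraticForm K V) (s : V ≃ₗ[K] V) : Prop :=
  ∃ c : K, c ≠ 0 ∧ ∀ x : V, Q (s x) = c * Q x

/-- `v` belongs to the group `O⁺(Q)` of positive isometries (rotations) of an even-dimensional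
regular quadratic space `(V, Q)`: it preserves `Q`, and its determinant is `1` if the
characteristic is not `2`, whereas its Dickson invariant, the rank of `v - id` modulo `2`, is `0`
if the characteristic is `2` (where all isometries have determinant `1`). -/
def IsPositiveIsometry {K : Type u} [Field K] {V : Type v} [AddCommGroup V] [Module K V]
    (Q : QuadraticForm K V) (v : V ≃ₗ[K] V) : Prop :=
  (∀ x : V, Q (v x) = Q x) ∧
    ((2 : K) ≠ 0 → LinearMap.det (v : V →ₗ[K] V) = 1) ∧
    ((2 : K) = 0 →
      Even (Module.finrank K (LinearMap.range ((v : V →ₗ[K] V) - LinearMap.id))))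

/-- `s` belongs to the group `GO⁺(Q)` of positive similarities of an even-dimensional regular
quadratic space `(V, Q)`: it is a similarity, and over the algebraic closure of `K` its
extension is the product of a nonzero scalar and a positive isometry. -/
def IsPositiveSimilarity {K : Type u} [Field K] {V : Type v} [AddCommGroup V] [Module K V]
    (Q : QuadraticForm K V) (s : V ≃ₗ[K] V) : Prop :=
  IsSimilarity Q s ∧
    ∃ (μ : AlgebraicClosure K)
      (v : (AlgebraicClosure K ⊗[K] V) ≃ₗ[AlgebraicClosure K] (AlgebraicClosure K ⊗[K] V)),
      μ ≠ 0 ∧ IsPositiveIsometry (extendScalars (AlgebraicClosure K) Q) v ∧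
        ∀ z : AlgebraicClosure K ⊗[K] V,
          LinearMap.baseChange (AlgebraicClosure K) (s : V →ₗ[K] V) z = μ • v z

end General

section Pfaffian

universe u

/-- The space `A₄(K)` of alternating `4 × 4` matrices: skew-symmetric with zero diagonal. -/
def Alt4 (K : Type u) [Field K] : Submodule K (Matrix (Fin 4) (Fin 4) K) where
  carrier := {M | Mᵀ = -M ∧ ∀ i, M i i = 0}
  zero_mem' := by simp
  add_mem' := by
    rintro M N ⟨hM, hM'⟩ ⟨hN, hN'⟩
    refine ⟨?_, fun i => ?_⟩
    · rw [Matrix.transpose_add, hM, hN, neg_add]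
    · simp [hM', hN']
  smul_mem' := by
    rintro c M ⟨hM, hM'⟩
    refine ⟨?_, fun i => ?_⟩
    · rw [Matrix.transpose_smul, hM, smul_neg]
    · simp [hM']

/-- The coordinate form `M ↦ M i j` on `A₄(K)`. -/
def entry (K : Type u) [Field K] (i j : Fin 4) : Alt4 K →ₗ[K] K :=
  Matrix.entryLinearMap K K i j ∘ₗ (Alt4 K).subtype

/-- The pfaffian as a quadratic form on `A₄(K)`. -/
def pf (K : Type u) [Field K] : QuadraticForm K (Alt4 K) :=
  QuadraticMap.linMulLin (entry K 0 1) (entry K 2 3)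
    - QuadraticMap.linMulLin (entry K 0 2) (entry K 1 3)
    + QuadraticMap.linMulLin (entry K 0 3) (entry K 1 2)

theorem pf_apply (K : Type u) [Field K] (M : Alt4 K) :
    pf K M = M.1 0 1 * M.1 2 3 - M.1 0 2 * M.1 1 3 + M.1 0 3 * M.1 1 2 := rfl

theorem smul_congr_mem {K : Type u} [Field K] (c : K) (P : Matrix (Fin 4) (Fin 4) K)
    {M : Matrix (Fin 4) (Fin 4) K} (hM : M ∈ Alt4 K) : c • (P * M * Pᵀ) ∈ Alt4 K := by
  refine (Alt4 K).smul_mem c ⟨?_, fun i => ?_⟩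
  · rw [Matrix.transpose_mul, Matrix.transpose_mul, hM.1, Matrix.transpose_transpose,
      Matrix.neg_mul, Matrix.mul_neg, Matrix.mul_assoc]
  · have h := fun i j => congrFun (congrFun hM.1 i) j
    have h10 := h 0 1
    have h20 := h 0 2
    have h30 := h 0 3
    have h21 := h 1 2
    have h31 := h 1 3
    have h32 := h 2 3
    simp only [Matrix.transpose_apply, Matrix.neg_apply] at h10 h20 h30 h21 h31 h32
    simp only [Matrix.mul_apply, Fin.sum_univ_four, Matrix.transpose_apply, hM.2, h10, h20, h30,
      h21, h31, h32]
    ring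

/-- The automorphism `M ↦ c • P M Pᵀ` of the vector space `A₄(K)`. -/
def congrMap {K : Type u} [Field K] (c : Kˣ) (P : GL (Fin 4) K) : Alt4 K ≃ₗ[K] Alt4 K where
  toFun M := ⟨(c : K) • (P.1 * M.1 * P.1ᵀ), smul_congr_mem _ _ M.2⟩
  map_add' M N := Subtype.ext (by simp [Matrix.mul_add, Matrix.add_mul])
  map_smul' a M := Subtype.ext (by simp [smul_comm a])
  invFun M := ⟨((c⁻¹ : Kˣ) : K) • ((P⁻¹).1 * M.1 * (P⁻¹).1ᵀ), smul_congr_mem _ _ M.2⟩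
  left_inv M := Subtype.ext (by
    have h : (P⁻¹).1 * P.1 = 1 := by rw [← Units.val_mul, inv_mul_cancel]; rfl
    have h' : P.1ᵀ * (P⁻¹).1ᵀ = 1 := by rw [← Matrix.transpose_mul, h, Matrix.transpose_one]
    calc ((c⁻¹ : Kˣ) : K) • ((P⁻¹).1 * ((c : K) • (P.1 * M.1 * P.1ᵀ)) * (P⁻¹).1ᵀ)
        = (((c⁻¹ : Kˣ) : K) * (c : K)) •
            (((P⁻¹).1 * P.1) * M.1 * (P.1ᵀ * (P⁻¹).1ᵀ)) := by
          simp only [Matrix.mul_smul, Matrix.smul_mul, smul_smul, Matrix.mul_assoc]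
      _ = M.1 := by rw [h, h', Units.inv_mul]; simp)
  right_inv M := Subtype.ext (by
    have h : P.1 * (P⁻¹).1 = 1 := by rw [← Units.val_mul, mul_inv_cancel]; rfl
    have h' : (P⁻¹).1ᵀ * P.1ᵀ = 1 := by rw [← Matrix.transpose_mul, h, Matrix.transpose_one]
    calc (c : K) • (P.1 * (((c⁻¹ : Kˣ) : K) • ((P⁻¹).1 * M.1 * (P⁻¹).1ᵀ)) * P.1ᵀ)
        = ((c : K) * ((c⁻¹ : Kˣ) : K)) •
            ((P.1 * (P⁻¹).1) * M.1 * ((P⁻¹).1ᵀ * P.1ᵀ)) := by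
          simp only [Matrix.mul_smul, Matrix.smul_mul, smul_smul, Matrix.mul_assoc]
      _ = M.1 := by rw [h, h', Units.mul_inv]; simp)

theorem congrMap_apply {K : Type u} [Field K] (c : Kˣ) (P : GL (Fin 4) K) (M : Alt4 K) :
    (congrMap c P M : Matrix (Fin 4) (Fin 4) K) =
      (c : K) • ((P : Matrix (Fin 4) (Fin 4) K) * (M : Matrix (Fin 4) (Fin 4) K) *
        (P : Matrix (Fin 4) (Fin 4) K)ᵀ) := rfl

end Pfaffian

end PfaffianSimilarity

end

/-! The Hodge star of alternating matrices satisfies `M * star M = -Pf M`, a Clifford-type relation.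
It shows that each reflection is a congruence composed with the star (`exists_reflection`) and that
each Siegel transformation is a congruence (`exists_siegel`). The star normalises the group of maps
`M ↦ c • P M Pᵀ` (`hodge_congrMap`) and lies outside it (`hodge_ne_congrMap`).

For an isometry `v`, either some `v x - x` is nonsingular and a reflection lowers the rank of `v -
id` by one, or `v - id` has totally singular range and `v`, if not the identity, is a Siegel
transformation, of rank two. By induction the parity of this rank decides between the congruence
group and its star coset, and fixes the determinant (`isometry_parity`). So, over every field and in
every characteristic, the positive isometries are the isometries that are congruences.

For a similarity, a congruence over `K` cancels the multiplier, which puts the similarity in the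
group or in the star coset; extension to the algebraic closure rules out the coset. Conversely, a
congruence divided by a square root of its multiplier is an isometry over the closure, hence
positive. -/

noncomputable section

namespace PfaffianSimilarity

/-! ### Isometries of a quadratic space and the rank of `v - id` -/

section Isometry

variable {F V : Type*} [Field F] [AddCommGroup V] [Module F V]

theorem polar_map_of_isometry {Q : QuadraticForm F V} {v : V →ₗ[F] V} (hv : ∀ x, Q (v x) = Q x)
    (x y : V) : QuadraticMap.polar Q (v x) (v y) = QuadraticMap.polar Q x y := by
  simp only [QuadraticMap.polar, ← map_add, hv]

theorem polar_sub_left (Q : QuadraticForm F V) (x y z : V) :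
    QuadraticMap.polar Q (x - y) z = QuadraticMap.polar Q x z - QuadraticMap.polar Q y z := by
  rw [sub_eq_add_neg, QuadraticMap.polar_add_left, QuadraticMap.polar_neg_left, sub_eq_add_neg]

theorem polar_sub_right (Q : QuadraticForm F V) (x y z : V) :
    QuadraticMap.polar Q x (y - z) = QuadraticMap.polar Q x y - QuadraticMap.polar Q x z := by
  rw [sub_eq_add_neg, QuadraticMap.polar_add_right, QuadraticMap.polar_neg_right, sub_eq_add_neg]

/-- Composing an isometry `v` with the reflection along a nonsingular vector of the range of
`v - id` lowers the rank of `v - id` by one. -/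
theorem finrank_range_reflection_comp_sub_id [FiniteDimensional F V] {Q : QuadraticForm F V}
    {v w : V →ₗ[F] V} (hv : ∀ x, Q (v x) = Q x) (x : V) (hu : Q (v x - x) ≠ 0)
    (hw : ∀ z, w z = v z - (QuadraticMap.polar Q (v z) (v x - x) / Q (v x - x)) • (v x - x)) :
    Module.finrank F (LinearMap.range (w - LinearMap.id)) + 1 =
      Module.finrank F (LinearMap.range (v - LinearMap.id)) := by
  set u := v x - x with hudef
  have hu0 : u ≠ 0 := fun h => hu (by rw [h, map_zero])
  -- Since `v x - u = x` has the same value of `Q` as `v x`, the reflection along `u` sends `v x`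
  -- back to `x`.
  have hpolar : QuadraticMap.polar Q (v x) u = Q u := by
    have h1 : Q (v x - u) = Q (v x) := by rw [hudef, sub_sub_cancel, hv]
    have h2 := QuadraticMap.map_add Q (v x) (-u)
    rw [← sub_eq_add_neg, h1, QuadraticMap.map_neg, QuadraticMap.polar_neg_right] at h2
    linear_combination h2
  have hwx : w x = x := by
    rw [hw, hpolar, div_self hu, one_smul, hudef, sub_sub_cancel]
  -- Vectors fixed by `v` are orthogonal to `u`, so they stay fixed, and `x` is a new fixed vector.
  -- The rank drops by at least one, and by at most one because the ranges agree modulo `u`.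
  have hker : LinearMap.ker (v - LinearMap.id) < LinearMap.ker (w - LinearMap.id) := by
    refine lt_of_le_of_ne (fun z hz => ?_) (fun h => ?_)
    · have hz' : v z = z := by simpa [sub_eq_zero] using hz
      have : QuadraticMap.polar Q (v z) u = 0 := by
        rw [hudef, polar_sub_right, polar_map_of_isometry hv, hz', sub_self]
      rw [LinearMap.mem_ker, LinearMap.sub_apply, hw, this, zero_div, zero_smul, sub_zero, hz']
      exact sub_self z
    · have : x ∈ LinearMap.ker (v - LinearMap.id) := by rw [h]; simp [hwx]
      exact hu0 (by simpa using this)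
  have h1 := Submodule.finrank_lt_finrank_of_lt hker
  have h2 := LinearMap.finrank_range_add_finrank_ker (v - LinearMap.id)
  have h3 := LinearMap.finrank_range_add_finrank_ker (w - LinearMap.id)
  have h4 : LinearMap.range (v - LinearMap.id) ≤
      LinearMap.range (w - LinearMap.id) ⊔ Submodule.span F {u} := by
    rintro _ ⟨z, rfl⟩
    refine Submodule.mem_sup.2 ⟨_, ⟨z, rfl⟩, (QuadraticMap.polar Q (v z) u / Q u) • u,
      Submodule.smul_mem _ _ (Submodule.mem_span_singleton_self u), ?_⟩
    simp [hw]
    abel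
  have h5 := Submodule.finrank_mono h4
  have h6 := Submodule.finrank_add_le_finrank_add_finrank (LinearMap.range (w - LinearMap.id))
    (Submodule.span F {u})
  have h7 := finrank_span_singleton (K := F) hu0
  omega

/-- In a regular quadratic space of dimension at most `7`, an isometry `v ≠ id` such that the
range of `v - id` is totally singular is a Siegel transformation. -/
theorem exists_siegel_of_totally_singular [FiniteDimensional F V] {Q : QuadraticForm F V}
    (hQ : ∀ x, (∀ y, QuadraticMap.polar Q x y = 0) → x = 0) (hdim : Module.finrank F V ≤ 7)
    {v : V →ₗ[F] V} (hv : ∀ x, Q (v x) = Q x) (hsing : ∀ x, Q (v x - x) = 0)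
    (hne : v ≠ LinearMap.id) :
    ∃ a b, Q a = 0 ∧ Q b = 0 ∧ QuadraticMap.polar Q a b = 0 ∧
      Module.finrank F (LinearMap.range (v - LinearMap.id)) = 2 ∧
      ∀ z, v z = z + QuadraticMap.polar Q z a • b - QuadraticMap.polar Q z b • a := by
  set B := QuadraticMap.polar Q with hB
  set N := v - LinearMap.id with hN
  have hNz : ∀ z, N z = v z - z := fun z => rfl
  have hcomm : ∀ x y, B x y = B y x := QuadraticMap.polar_comm Q
  have hNsing : ∀ x y, B (N x) (N y) = 0 := fun x y => by
    have := hsing (x + y)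
    have h : v (x + y) - (x + y) = N x + N y := by rw [hNz, hNz, map_add]; abel
    rw [h, QuadraticMap.map_add Q, hNz, hNz, hsing, hsing, zero_add, zero_add] at this
    exact this
  -- Expanding `Q (N x + x) = Q x` with `Q (N x) = 0` shows that `(x, y) ↦ B (N x) y` is
  -- alternating. Its rank, which is that of `N`, is therefore even.
  have halt : ∀ x, B (N x) x = 0 := fun x => by
    have h1 := QuadraticMap.map_add Q (N x) x
    have h2 : N x + x = v x := by rw [hNz]; abel
    rw [h2, hv, hNz, hsing, zero_add, left_eq_add] at h1
    exact h1
  have hskew : ∀ x y, B (N x) y = - B (N y) x := fun x y => by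
    have h := halt (x + y)
    rw [map_add, hB, QuadraticMap.polar_add_left, QuadraticMap.polar_add_right,
      QuadraticMap.polar_add_right, ← hB, halt, halt] at h
    linear_combination h
  obtain ⟨x, hx⟩ : ∃ x, N x ≠ 0 := by
    by_contra! h
    exact hne (LinearMap.ext fun z => sub_eq_zero.1 (h z))
  obtain ⟨y, hy⟩ : ∃ y, B (N x) y = 1 := by
    obtain ⟨y, hy⟩ : ∃ y, B (N x) y ≠ 0 := by
      by_contra! h
      exact hx (hQ _ h)
    exact ⟨(B (N x) y)⁻¹ • y, by
      rw [hB, QuadraticMap.polar_smul_right, ← hB, smul_eq_mul, inv_mul_cancel₀ hy]⟩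
  set a := N x with ha
  set b := N y with hb
  have hbx : B b x = -1 := by rw [hskew, hy]
  have hby : B b y = 0 := halt y
  have hax : B a x = 0 := halt x
  -- The part of `N` that is left after a Siegel transformation is split off.
  let D : V → V := fun z => N z - (B z a • b - B z b • a)
  have hDx : ∀ z, B (D z) x = 0 := fun z => by
    simp only [D, hB, polar_sub_left, QuadraticMap.polar_smul_left, smul_eq_mul]
    rw [← hB, hbx, hax, hskew, ← ha, hcomm z a]; ring
  have hDy : ∀ z, B (D z) y = 0 := fun z => by
    simp only [D, hB, polar_sub_left, QuadraticMap.polar_smul_left, smul_eq_mul]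
    rw [← hB, hy, hby, hskew, ← hb, hcomm z b]; ring
  have hDmem : ∀ z, D z ∈ LinearMap.range N := fun z =>
    Submodule.sub_mem _ ⟨z, rfl⟩ (Submodule.sub_mem _ (Submodule.smul_mem _ _ ⟨y, rfl⟩)
      (Submodule.smul_mem _ _ ⟨x, rfl⟩))
  have hDalt : ∀ z, B (D z) z = 0 := fun z => by
    simp only [D, hB, polar_sub_left, QuadraticMap.polar_smul_left, smul_eq_mul]
    rw [← hB, halt, hcomm z a, hcomm z b]; ring
  have hDskew : ∀ z w, B (D z) w = - B (D w) z := fun z w => by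
    simp only [D, hB, polar_sub_left, QuadraticMap.polar_smul_left, smul_eq_mul]
    rw [← hB, hskew, hcomm z a, hcomm z b, hcomm w a, hcomm w b]; ring
  -- The range of `N` lies in its own orthogonal, so twice its dimension is at most 7.
  have hrank : Module.finrank F (LinearMap.range N) ≤ 3 := by
    let β : LinearMap.BilinForm F V := QuadraticMap.polarBilin Q
    have hnd : β.Nondegenerate :=
      ⟨hQ, fun y hy => hQ y fun x => (hcomm y x).trans (hy x)⟩
    have hle : LinearMap.range N ≤ β.orthogonal (LinearMap.range N) := by
      rintro _ ⟨z, rfl⟩ _ ⟨w, rfl⟩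
      exact hNsing w z
    have h1 := Submodule.finrank_mono hle
    have h2 := LinearMap.BilinForm.finrank_orthogonal hnd (LinearMap.range N)
    have h3 := Submodule.finrank_le (LinearMap.range N)
    omega
  have hD : ∀ z, D z = 0 := by
    by_contra! h
    obtain ⟨z, hz⟩ := h
    obtain ⟨w, hw⟩ : ∃ w, B (D z) w ≠ 0 := by
      by_contra! h
      exact hz (hQ _ h)
    -- A nonzero remainder would give a second hyperbolic pair of the alternating form, hence rank
    -- at least 4. Pairing with `x`, `y`, `z`, `w` isolates the coefficients.
    have hind : LinearIndependent F ![a, b, D z, D w] := by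
      rw [Fintype.linearIndependent_iff]
      intro g hg
      have key : ∀ t, g 0 * B a t + g 1 * B b t + g 2 * B (D z) t + g 3 * B (D w) t = 0 := by
        intro t
        have := congrArg (fun s => B s t) hg
        simpa [Fin.sum_univ_four, hB, QuadraticMap.polar_add_left, QuadraticMap.polar_smul_left]
          using this
      have e1 : g 1 = 0 := by
        have := key x
        rw [hax, hbx, hDx, hDx] at this
        linear_combination -this
      have e0 : g 0 = 0 := by
        have := key y
        rw [hy, hby, hDy, hDy] at this
        linear_combination this
      have e3 : g 3 = 0 := by
        have := key z
        rw [e0, e1, hDalt, hDskew w z] at this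
        have h' : g 3 * B (D z) w = 0 := by linear_combination -this
        exact (mul_eq_zero.1 h').resolve_right hw
      have e2 : g 2 = 0 := by
        have := key w
        rw [e0, e1, hDalt] at this
        have h' : g 2 * B (D z) w = 0 := by linear_combination this
        exact (mul_eq_zero.1 h').resolve_right hw
      intro i
      fin_cases i <;> assumption
    have hspan : Submodule.span F (Set.range ![a, b, D z, D w]) ≤ LinearMap.range N := by
      rw [Submodule.span_le]
      rintro _ ⟨i, rfl⟩
      fin_cases i
      · exact ⟨x, rfl⟩
      · exact ⟨y, rfl⟩
      · exact hDmem z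
      · exact hDmem w
    have h1 := Submodule.finrank_mono hspan
    rw [finrank_span_eq_card hind, Fintype.card_fin] at h1
    omega
  have hform : ∀ z, N z = B z a • b - B z b • a := fun z => sub_eq_zero.1 (hD z)
  refine ⟨a, b, hsing x, hsing y, hNsing x y, ?_, fun z => ?_⟩
  · have hind : LinearIndependent F ![a, b] := by
      rw [Fintype.linearIndependent_iff]
      intro g hg
      have key : ∀ t, g 0 * B a t + g 1 * B b t = 0 := by
        intro t
        have := congrArg (fun s => B s t) hg
        simpa [hB, QuadraticMap.polar_add_left, QuadraticMap.polar_smul_left] using this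
      have e1 : g 1 = 0 := by
        have := key x
        rw [hax, hbx] at this
        linear_combination -this
      have e0 : g 0 = 0 := by
        have := key y
        rw [hy, hby] at this
        linear_combination this
      intro i
      fin_cases i <;> assumption
    have hspan : LinearMap.range N = Submodule.span F (Set.range ![a, b]) := by
      apply le_antisymm
      · rintro _ ⟨z, rfl⟩
        rw [hform]
        exact Submodule.sub_mem _
          (Submodule.smul_mem _ _ (Submodule.subset_span ⟨1, rfl⟩))
          (Submodule.smul_mem _ _ (Submodule.subset_span ⟨0, rfl⟩))
      · rw [Submodule.span_le]
        rintro _ ⟨i, rfl⟩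
        fin_cases i
        · exact ⟨x, rfl⟩
        · exact ⟨y, rfl⟩
    rw [hspan, finrank_span_eq_card hind, Fintype.card_fin]
  · rw [add_sub_assoc, ← hform, hNz]; abel

end Isometry

/-! ### The Hodge star and its commutation with congruences -/

section HodgeStar

universe u

variable {K : Type u} [Field K]

theorem alt_diag_eq_zero (M : Alt4 K) (i : Fin 4) : M.1 i i = 0 := M.2.2 i

theorem alt_transpose_eq_neg (M : Alt4 K) : M.1ᵀ = -M.1 := M.2.1

theorem alt_apply_swap (M : Alt4 K) (i j : Fin 4) : M.1 i j = - M.1 j i := by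
  have := congrFun (congrFun M.2.1 j) i
  simpa using this

theorem alt_eq_of (M : Alt4 K) : M.1 =
    !![0, M.1 0 1, M.1 0 2, M.1 0 3; -M.1 0 1, 0, M.1 1 2, M.1 1 3;
      -M.1 0 2, -M.1 1 2, 0, M.1 2 3; -M.1 0 3, -M.1 1 3, -M.1 2 3, 0] := by
  ext i j
  fin_cases i <;> fin_cases j <;>
    first
    | exact alt_diag_eq_zero M _
    | rfl
    | exact alt_apply_swap M _ _

/-- The alternating matrix with the given six coefficients above the diagonal. -/
def altOf (c : Fin 6 → K) : Alt4 K :=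
  ⟨!![0, c 0, c 1, c 2; -c 0, 0, c 3, c 4; -c 1, -c 3, 0, c 5; -c 2, -c 4, -c 5, 0], by
    ext i j; fin_cases i <;> fin_cases j <;> simp, by intro i; fin_cases i <;> rfl⟩

/-- The coordinates above the diagonal of an alternating matrix. -/
def altEquiv (K : Type u) [Field K] : Alt4 K ≃ₗ[K] (Fin 6 → K) where
  toFun M := ![M.1 0 1, M.1 0 2, M.1 0 3, M.1 1 2, M.1 1 3, M.1 2 3]
  map_add' M N := by ext i; fin_cases i <;> rfl
  map_smul' c M := by ext i; fin_cases i <;> rfl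
  invFun := altOf
  left_inv M := Subtype.ext (alt_eq_of M).symm
  right_inv c := by ext i; fin_cases i <;> rfl

instance : FiniteDimensional K (Alt4 K) := Module.Finite.equiv (altEquiv K).symm

theorem finrank_Alt4 : Module.finrank K (Alt4 K) = 6 := by
  rw [(altEquiv K).finrank_eq, Module.finrank_fin_fun]

theorem alt_ext {M N : Alt4 K} (h01 : M.1 0 1 = N.1 0 1) (h02 : M.1 0 2 = N.1 0 2)
    (h03 : M.1 0 3 = N.1 0 3) (h12 : M.1 1 2 = N.1 1 2) (h13 : M.1 1 3 = N.1 1 3)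
    (h23 : M.1 2 3 = N.1 2 3) : M = N :=
  Subtype.ext (by rw [alt_eq_of M, alt_eq_of N, h01, h02, h03, h12, h13, h23])

/-- The Hodge star of alternating matrices: `M * star M = - Pf M`. -/
def hodge (K : Type u) [Field K] : Alt4 K ≃ₗ[K] Alt4 K :=
  LinearEquiv.ofInvolutive
    { toFun := fun M => altOf ![M.1 2 3, -M.1 1 3, M.1 1 2, M.1 0 3, -M.1 0 2, M.1 0 1]
      map_add' := fun M N => by
        apply alt_ext <;> simp [altOf] <;> ring
      map_smul' := fun c M => by
        apply alt_ext <;> simp [altOf] }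
    (fun M => by apply alt_ext <;> simp [altOf])

theorem hodge_apply (M : Alt4 K) :
    hodge K M = altOf ![M.1 2 3, -M.1 1 3, M.1 1 2, M.1 0 3, -M.1 0 2, M.1 0 1] := rfl

theorem hodge_hodge (M : Alt4 K) : hodge K (hodge K M) = M := (hodge K).left_inv M

theorem pf_hodge (M : Alt4 K) : pf K (hodge K M) = pf K M := by
  rw [pf_apply, pf_apply, hodge_apply]
  simp [altOf]
  ring

theorem mul_hodge (M : Alt4 K) :
    M.1 * (hodge K M).1 = (-pf K M) • (1 : Matrix (Fin 4) (Fin 4) K) := by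
  rw [pf_apply, hodge_apply, altOf, alt_eq_of M]
  ext i j
  fin_cases i <;> fin_cases j <;> simp [Matrix.mul_apply, Fin.sum_univ_four] <;> ring

theorem hodge_mul (M : Alt4 K) :
    (hodge K M).1 * M.1 = (-pf K M) • (1 : Matrix (Fin 4) (Fin 4) K) := by
  have h := mul_hodge (hodge K M)
  rwa [hodge_hodge, pf_hodge] at h

/-- Polarization of `mul_hodge`: the Clifford relation used to exchange factors in products. -/
theorem mul_hodge_add (M N : Alt4 K) :
    M.1 * (hodge K N).1 + N.1 * (hodge K M).1 =
      (-QuadraticMap.polar (pf K) M N) • (1 : Matrix (Fin 4) (Fin 4) K) := by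
  have h := mul_hodge (M + N)
  rw [QuadraticMap.map_add (pf K), map_add] at h
  simp only [Submodule.coe_add, Matrix.add_mul, Matrix.mul_add, mul_hodge, neg_add, add_smul] at h
  rw [← sub_eq_zero] at h ⊢
  rw [← h, neg_smul]; abel

theorem hodge_mul_add (M N : Alt4 K) :
    (hodge K M).1 * N.1 + (hodge K N).1 * M.1 =
      (-QuadraticMap.polar (pf K) M N) • (1 : Matrix (Fin 4) (Fin 4) K) := by
  have h := hodge_mul (M + N)
  rw [QuadraticMap.map_add (pf K), map_add] at h
  simp only [Submodule.coe_add, Matrix.add_mul, Matrix.mul_add, hodge_mul, neg_add, add_smul] at h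
  rw [← sub_eq_zero] at h ⊢
  rw [← h, neg_smul]; abel

theorem polar_pf (M N : Alt4 K) : QuadraticMap.polar (pf K) M N =
    M.1 0 1 * N.1 2 3 + M.1 2 3 * N.1 0 1 - M.1 0 2 * N.1 1 3 - M.1 1 3 * N.1 0 2
      + M.1 0 3 * N.1 1 2 + M.1 1 2 * N.1 0 3 := by
  simp only [QuadraticMap.polar, pf_apply, Submodule.coe_add, Matrix.add_apply]
  ring

theorem polar_pf_nondegenerate (M : Alt4 K) (h : ∀ N, QuadraticMap.polar (pf K) M N = 0) :
    M = 0 := by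
  have key : ∀ c, QuadraticMap.polar (pf K) M (altOf c) = 0 := fun c => h _
  simp only [polar_pf] at key
  apply alt_ext
  · simpa [altOf] using key ![0, 0, 0, 0, 0, 1]
  · simpa [altOf] using key ![0, 0, 0, 0, 1, 0]
  · simpa [altOf] using key ![0, 0, 0, 1, 0, 0]
  · simpa [altOf] using key ![0, 0, 1, 0, 0, 0]
  · simpa [altOf] using key ![0, 1, 0, 0, 0, 0]
  · simpa [altOf] using key ![1, 0, 0, 0, 0, 0]

theorem pf_congrMap (c : Kˣ) (P : GL (Fin 4) K) (M : Alt4 K) :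
    pf K (congrMap c P M) = (c : K) ^ 2 * P.1.det * pf K M := by
  rw [pf_apply, pf_apply, congrMap_apply, alt_eq_of M]
  generalize (P : Matrix (Fin 4) (Fin 4) K) = P
  simp [Matrix.mul_apply, Matrix.det_succ_row_zero, Fin.sum_univ_succ,
    Fin.succAbove]
  ring

theorem polar_congrMap (c : Kˣ) (P : GL (Fin 4) K) (M N : Alt4 K) :
    QuadraticMap.polar (pf K) (congrMap c P M) (congrMap c P N) =
      (c : K) ^ 2 * P.1.det * QuadraticMap.polar (pf K) M N := by
  simp only [QuadraticMap.polar, ← map_add, pf_congrMap]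
  ring

theorem polar_hodge (M N : Alt4 K) :
    QuadraticMap.polar (pf K) (hodge K M) N = QuadraticMap.polar (pf K) M (hodge K N) := by
  simp only [polar_pf, hodge_apply]
  simp [altOf]
  ring

/-- The inverse transpose of an invertible matrix. -/
def invTranspose (P : GL (Fin 4) K) : GL (Fin 4) K where
  val := (P⁻¹).1ᵀ
  inv := P.1ᵀ
  val_inv := by rw [← Matrix.transpose_mul, Units.mul_inv, Matrix.transpose_one]
  inv_val := by rw [← Matrix.transpose_mul, Units.inv_mul, Matrix.transpose_one]

/-- Pairing `M` with `hodge K N` gives the dot product of the coordinates above the diagonal, for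
which the adjoint of a congruence is congruence by the transpose. -/
theorem polar_congrMap_invTranspose (c : Kˣ) (P : GL (Fin 4) K) (M N : Alt4 K) :
    QuadraticMap.polar (pf K) (congrMap c (invTranspose P) M) (hodge K N) =
      QuadraticMap.polar (pf K) M (hodge K (congrMap c P⁻¹ N)) := by
  simp only [polar_pf, hodge_apply, congrMap_apply, invTranspose]
  rw [alt_eq_of M, alt_eq_of N]
  generalize (P⁻¹ : GL (Fin 4) K).1 = R
  simp [Matrix.mul_apply, Fin.sum_univ_four, altOf]
  ring

theorem congrMap_congrMap (c d : Kˣ) (P R : GL (Fin 4) K) (M : Alt4 K) :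
    congrMap c P (congrMap d R M) = congrMap (c * d) (P * R) M := by
  apply Subtype.ext
  simp only [congrMap_apply, Units.val_mul, Matrix.transpose_mul, Matrix.mul_smul,
    Matrix.smul_mul, smul_smul, Matrix.mul_assoc]

theorem congrMap_one_one (M : Alt4 K) : congrMap 1 1 M = M := by
  apply Subtype.ext
  simp [congrMap_apply]

/-- By nondegeneracy it suffices to pair both sides with `N`. The two adjoints of a congruence, for
the polar form and for the dot product, then differ only by the multiplier. -/
theorem hodge_congrMap (c : Kˣ) (P : GL (Fin 4) K) (M : Alt4 K) :
    hodge K (congrMap c P M) =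
      congrMap (c * Matrix.GeneralLinearGroup.det P) (invTranspose P) (hodge K M) := by
  rw [← sub_eq_zero]
  apply polar_pf_nondegenerate
  intro N
  have h1 : QuadraticMap.polar (pf K) (hodge K (congrMap c P M)) N =
      (c : K) ^ 2 * P.1.det *
        QuadraticMap.polar (pf K) M (congrMap c⁻¹ P⁻¹ (hodge K N)) := by
    rw [← polar_congrMap, congrMap_congrMap, mul_inv_cancel, mul_inv_cancel, congrMap_one_one,
      polar_hodge]
  have h2 := polar_congrMap_invTranspose (c * Matrix.GeneralLinearGroup.det P) P (hodge K M)
    (hodge K N)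
  rw [hodge_hodge, polar_hodge, hodge_hodge] at h2
  have h3 : congrMap (c * Matrix.GeneralLinearGroup.det P) P⁻¹ (hodge K N) =
      ((c : K) ^ 2 * P.1.det) • congrMap c⁻¹ P⁻¹ (hodge K N) := by
    apply Subtype.ext
    rw [Submodule.coe_smul, congrMap_apply, congrMap_apply, smul_smul]
    congr 1
    rw [Units.val_mul, Matrix.GeneralLinearGroup.val_det_apply, Units.val_inv_eq_inv_val]
    field_simp [c.ne_zero]
  rw [sub_eq_add_neg, QuadraticMap.polar_add_left, QuadraticMap.polar_neg_left, h1, h2, h3,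
    QuadraticMap.polar_smul_right, smul_eq_mul, add_neg_cancel]

/-- No congruence map is the Hodge star. -/
theorem hodge_ne_congrMap (c : Kˣ) (P : GL (Fin 4) K) : hodge K ≠ congrMap c P := by
  intro h
  have key : ∀ M : Alt4 K, (hodge K M).1 * (P⁻¹).1ᵀ = (c : K) • (P.1 * M.1) := by
    intro M
    have h' : P.1ᵀ * (P⁻¹).1ᵀ = 1 := by
      rw [← Matrix.transpose_mul, Units.inv_mul, Matrix.transpose_one]
    rw [h, congrMap_apply, Matrix.smul_mul, Matrix.mul_assoc, h', Matrix.mul_one]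
  have hrow : ∀ M : Alt4 K, (∀ k, (hodge K M).1 0 k = 0) → ∀ j, (P.1 * M.1) 0 j = 0 := by
    intro M hM j
    have h1 := congrFun (congrFun (key M) 0) j
    rw [Matrix.mul_apply, Finset.sum_eq_zero fun k _ => by rw [hM k, zero_mul],
      Matrix.smul_apply, smul_eq_mul] at h1
    exact (mul_eq_zero.1 h1.symm).resolve_left c.ne_zero
  -- The basis matrices involving index 0 have stars supported on the indices 1, 2, 3; together they
  -- annihilate the whole first row of `P`.
  have h1 := hrow (altOf ![1, 0, 0, 0, 0, 0]) fun k => by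
    fin_cases k <;> simp [hodge_apply, altOf]
  have h2 := hrow (altOf ![0, 1, 0, 0, 0, 0]) fun k => by
    fin_cases k <;> simp [hodge_apply, altOf]
  have h3 := hrow (altOf ![0, 0, 1, 0, 0, 0]) fun k => by
    fin_cases k <;> simp [hodge_apply, altOf]
  have hP : ∀ j, P.1 0 j = 0 := by
    intro j
    fin_cases j
    · simpa [Matrix.mul_apply, Fin.sum_univ_four, altOf] using h1 1
    · simpa [Matrix.mul_apply, Fin.sum_univ_four, altOf] using h1 0
    · simpa [Matrix.mul_apply, Fin.sum_univ_four, altOf] using h2 0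
    · simpa [Matrix.mul_apply, Fin.sum_univ_four, altOf] using h3 0
  exact (Matrix.GeneralLinearGroup.det P).ne_zero (Matrix.det_eq_zero_of_row_eq_zero 0 hP)

end HodgeStar

/-! ### The congruence group and the isometries of the pfaffian -/

section Isometries

universe u

variable {K : Type u} [Field K]

/-- The group of the automorphisms `M ↦ c • P M Pᵀ` of `A₄(K)`. -/
def congrGroup (K : Type u) [Field K] : Subgroup (Alt4 K ≃ₗ[K] Alt4 K) where
  carrier := {s | ∃ (c : Kˣ) (P : GL (Fin 4) K), s = congrMap c P}
  mul_mem' := by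
    rintro _ _ ⟨c, P, rfl⟩ ⟨d, R, rfl⟩
    exact ⟨c * d, P * R, LinearEquiv.ext fun M => congrMap_congrMap c d P R M⟩
  one_mem' := ⟨1, 1, LinearEquiv.ext fun M => (congrMap_one_one M).symm⟩
  inv_mem' := by
    rintro _ ⟨c, P, rfl⟩
    refine ⟨c⁻¹, P⁻¹, inv_eq_of_mul_eq_one_right (LinearEquiv.ext fun M => ?_)⟩
    rw [LinearEquiv.mul_apply, congrMap_congrMap, mul_inv_cancel, mul_inv_cancel,
      congrMap_one_one, LinearEquiv.coe_one, id]

theorem congrMap_mem_congrGroup (c : Kˣ) (P : GL (Fin 4) K) : congrMap c P ∈ congrGroup K :=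
  ⟨c, P, rfl⟩

theorem hodge_mul_hodge : hodge K * hodge K = 1 := LinearEquiv.ext hodge_hodge

theorem hodge_notMem_congrGroup : hodge K ∉ congrGroup K := fun ⟨c, P, h⟩ =>
  hodge_ne_congrMap c P h

/-- The star normalises the congruence group, so factors of the star can be moved past congruences.
-/
theorem hodge_mul_mul_hodge_mem {g : Alt4 K ≃ₗ[K] Alt4 K} (hg : g ∈ congrGroup K) :
    hodge K * g * hodge K ∈ congrGroup K := by
  obtain ⟨c, P, rfl⟩ := hg
  refine ⟨c * Matrix.GeneralLinearGroup.det P, invTranspose P, LinearEquiv.ext fun M => ?_⟩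
  rw [LinearEquiv.mul_apply, LinearEquiv.mul_apply, hodge_congrMap, hodge_hodge]

/-- The reflection along a nonsingular `u` is `M ↦ - Pf(u)⁻¹ u (star M) uᵀ`. -/
theorem exists_reflection {u : Alt4 K} (hu : pf K u ≠ 0) :
    ∃ g ∈ congrGroup K, ∀ M, (g * hodge K) M =
      M - (QuadraticMap.polar (pf K) M u / pf K u) • u := by
  have hu' : -pf K u ≠ 0 := neg_ne_zero.2 hu
  let P : GL (Fin 4) K :=
    { val := u.1
      inv := (-pf K u)⁻¹ • (hodge K u).1
      val_inv := by rw [Matrix.mul_smul, mul_hodge, smul_smul, inv_mul_cancel₀ hu', one_smul]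
      inv_val := by rw [Matrix.smul_mul, hodge_mul, smul_smul, inv_mul_cancel₀ hu', one_smul] }
  refine ⟨_, congrMap_mem_congrGroup (Units.mk0 _ hu')⁻¹ P, fun M => Subtype.ext ?_⟩
  rw [LinearEquiv.mul_apply, congrMap_apply, Units.val_inv_eq_inv_val, Units.val_mk0]
  change (-pf K u)⁻¹ • (u.1 * (hodge K M).1 * u.1ᵀ) = _
  have h1 : u.1 * (hodge K M).1 =
      (-QuadraticMap.polar (pf K) u M) • (1 : Matrix (Fin 4) (Fin 4) K) - M.1 * (hodge K u).1 :=
    eq_sub_of_add_eq (mul_hodge_add u M)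
  rw [alt_transpose_eq_neg, h1, Matrix.mul_neg, Matrix.sub_mul, Matrix.mul_assoc, hodge_mul,
    Matrix.smul_mul, Matrix.one_mul, Matrix.mul_smul, Matrix.mul_one, QuadraticMap.polar_comm]
  simp only [Submodule.coe_sub, Submodule.coe_smul]
  ext i j
  simp only [Matrix.smul_apply, Matrix.neg_apply, Matrix.sub_apply, smul_eq_mul]
  field_simp
  ring

/-- The Siegel transformations are congruences by transvections. -/
theorem exists_siegel {a b : Alt4 K} (ha : pf K a = 0) (hb : pf K b = 0)
    (hab : QuadraticMap.polar (pf K) a b = 0) :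
    ∃ g ∈ congrGroup K, ∀ M, g M =
      M + QuadraticMap.polar (pf K) M a • b - QuadraticMap.polar (pf K) M b • a := by
  have haa : a.1 * (hodge K a).1 = 0 := by rw [mul_hodge, ha, neg_zero, zero_smul]
  have hbb : (hodge K b).1 * b.1 = 0 := by rw [hodge_mul, hb, neg_zero, zero_smul]
  have hba : (hodge K b).1 * a.1 = - ((hodge K a).1 * b.1) := by
    have := hodge_mul_add a b
    rw [hab, neg_zero, zero_smul] at this
    exact eq_neg_of_add_eq_zero_right this
  have hba' : b.1 * (hodge K a).1 = - (a.1 * (hodge K b).1) := by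
    have := mul_hodge_add a b
    rw [hab, neg_zero, zero_smul] at this
    exact eq_neg_of_add_eq_zero_right this
  have hsq : (a.1 * (hodge K b).1) * (a.1 * (hodge K b).1) = 0 := by
    rw [Matrix.mul_assoc, ← Matrix.mul_assoc _ a.1, hba, Matrix.neg_mul, Matrix.mul_neg,
      Matrix.mul_assoc, ← Matrix.mul_assoc a.1, haa, Matrix.zero_mul, neg_zero]
  -- `a * star b` squares to zero, so `1 + a * star b` is unipotent with inverse `1 - a * star b`.
  let P : GL (Fin 4) K :=
    { val := 1 + a.1 * (hodge K b).1
      inv := 1 - a.1 * (hodge K b).1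
      val_inv := by
        rw [Matrix.add_mul, Matrix.mul_sub, Matrix.mul_sub, hsq]; simp
      inv_val := by
        rw [Matrix.sub_mul, Matrix.mul_add, Matrix.mul_add, hsq]; simp }
  refine ⟨_, congrMap_mem_congrGroup 1 P, fun M => Subtype.ext ?_⟩
  rw [congrMap_apply, Units.val_one, one_smul]
  change (1 + a.1 * (hodge K b).1) * M.1 * (1 + a.1 * (hodge K b).1)ᵀ = _
  have hbM : (hodge K b).1 * M.1 = (-QuadraticMap.polar (pf K) M b) •
      (1 : Matrix (Fin 4) (Fin 4) K) - (hodge K M).1 * b.1 :=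
    eq_sub_of_add_eq' (hodge_mul_add M b)
  have hMa : M.1 * (hodge K a).1 = (-QuadraticMap.polar (pf K) M a) •
      (1 : Matrix (Fin 4) (Fin 4) K) - a.1 * (hodge K M).1 :=
    eq_sub_of_add_eq (mul_hodge_add M a)
  rw [Matrix.transpose_add, Matrix.transpose_mul, alt_transpose_eq_neg, alt_transpose_eq_neg,
    Matrix.transpose_one, neg_mul_neg, hba]
  -- Both linear terms of `P M Pᵀ` contain `a * star M * b`, which cancels between them; the
  -- quadratic term vanishes by `e3`.
  have e1 : a.1 * (hodge K b).1 * M.1 =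
      (-QuadraticMap.polar (pf K) M b) • a.1 - a.1 * (hodge K M).1 * b.1 := by
    rw [Matrix.mul_assoc, hbM, Matrix.mul_sub, Matrix.mul_smul, Matrix.mul_one, Matrix.mul_assoc]
  have e2 : M.1 * ((hodge K a).1 * b.1) =
      (-QuadraticMap.polar (pf K) M a) • b.1 - a.1 * (hodge K M).1 * b.1 := by
    rw [← Matrix.mul_assoc, hMa, Matrix.sub_mul, Matrix.smul_mul, Matrix.one_mul]
  have e3 : a.1 * (hodge K b).1 * M.1 * ((hodge K a).1 * b.1) = 0 := by
    rw [e1, Matrix.sub_mul, Matrix.smul_mul, ← Matrix.mul_assoc a.1, haa, Matrix.zero_mul, smul_zero, Matrix.mul_assoc _ b.1, ← Matrix.mul_assoc b.1, hba',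
      Matrix.neg_mul, Matrix.mul_assoc a.1 _ b.1, hbb, Matrix.mul_zero, neg_zero,
      Matrix.mul_zero, sub_zero]
  rw [Matrix.add_mul, Matrix.mul_add, Matrix.one_mul, Matrix.mul_one, Matrix.mul_neg,
    Matrix.add_mul, e3, e2, e1]
  simp only [Submodule.coe_sub, Submodule.coe_add, Submodule.coe_smul, neg_smul]
  abel

/-- A map `id + f ⊗ u` has determinant `1 + f u`, and here `f u = -2`. -/
theorem det_reflection_eq {u : Alt4 K} (hu : pf K u ≠ 0) {r : Alt4 K →ₗ[K] Alt4 K}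
    (hr : ∀ M, r M = M - (QuadraticMap.polar (pf K) M u / pf K u) • u) :
    LinearMap.det r = -1 := by
  have h : r = LinearMap.transvection (-(pf K u)⁻¹ • (QuadraticMap.polarBilin (pf K)).flip u) u := by
    ext1 M
    rw [hr, LinearMap.transvection.apply]
    simp [sub_eq_add_neg, div_eq_inv_mul]
  rw [h, LinearMap.transvection.det]
  simp [QuadraticMap.polar_self]
  field_simp
  norm_num

theorem det_siegel_eq {a b : Alt4 K} (ha : pf K a = 0)
    (hab : QuadraticMap.polar (pf K) a b = 0) {r : Alt4 K →ₗ[K] Alt4 K}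
    (hr : ∀ M, r M =
      M + QuadraticMap.polar (pf K) M a • b - QuadraticMap.polar (pf K) M b • a) :
    LinearMap.det r = 1 := by
  have h : r = LinearMap.transvection ((QuadraticMap.polarBilin (pf K)).flip a) b ∘ₗ
      LinearMap.transvection (-(QuadraticMap.polarBilin (pf K)).flip b) a := by
    ext1 M
    have h2 : QuadraticMap.polar (pf K) a a = 0 := by simp [QuadraticMap.polar_self, ha]
    rw [hr, LinearMap.comp_apply, LinearMap.transvection.apply, LinearMap.transvection.apply]
    simp [h2]
    abel
  rw [h, LinearMap.det_comp, LinearMap.transvection.det, LinearMap.transvection.det]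
  simp [hab, QuadraticMap.polar_comm _ b a]

/-- An isometry `v` of the pfaffian lies in the congruence group or in its coset of the Hodge star
according to the parity of the rank of `v - id`, which also governs its determinant. -/
theorem isometry_parity (n : ℕ) : ∀ v : Alt4 K ≃ₗ[K] Alt4 K, (∀ M, pf K (v M) = pf K M) →
    Module.finrank K (LinearMap.range ((v : Alt4 K →ₗ[K] Alt4 K) - LinearMap.id)) = n →
    (Even n ∧ v ∈ congrGroup K ∧ LinearMap.det (v : Alt4 K →ₗ[K] Alt4 K) = 1) ∨
    (Odd n ∧ v * hodge K ∈ congrGroup K ∧ LinearMap.det (v : Alt4 K →ₗ[K] Alt4 K) = -1) := by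
  induction n with
  | zero =>
    intro v hv hn
    have h : (v : Alt4 K →ₗ[K] Alt4 K) = LinearMap.id := by
      rw [← sub_eq_zero, ← LinearMap.range_eq_bot]
      exact Submodule.finrank_eq_zero.1 hn
    have h1 : v = 1 := LinearEquiv.toLinearMap_injective h
    exact Or.inl ⟨Even.zero, h1 ▸ one_mem _, by rw [h, LinearMap.det_id]⟩
  | succ n ih =>
    intro v hv hn
    by_cases hsing : ∀ M, pf K (v M - M) = 0
    · have hne : (v : Alt4 K →ₗ[K] Alt4 K) ≠ LinearMap.id := by
        intro h
        rw [sub_eq_zero.2 h, LinearMap.range_zero, finrank_bot] at hn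
        omega
      obtain ⟨a, b, ha, hb, hab, hr, hform⟩ := exists_siegel_of_totally_singular
        polar_pf_nondegenerate (by rw [finrank_Alt4]; norm_num) hv hsing hne
      obtain ⟨g, hg, hgM⟩ := exists_siegel ha hb hab
      have hvg : v = g := LinearEquiv.ext fun M => (hform M).trans (hgM M).symm
      refine Or.inl ⟨?_, hvg ▸ hg, det_siegel_eq ha hab hform⟩
      rw [← hn, hr]
      exact even_two
    · push Not at hsing
      obtain ⟨x, hx⟩ := hsing
      obtain ⟨g, hg, hgM⟩ := exists_reflection hx
      have hrank := finrank_range_reflection_comp_sub_id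
        (v := (v : Alt4 K →ₗ[K] Alt4 K))
        (w := ((g * hodge K * v : Alt4 K ≃ₗ[K] Alt4 K) : Alt4 K →ₗ[K] Alt4 K)) hv x hx
        fun z => hgM (v z)
      rw [hn] at hrank
      have hdet : LinearMap.det ((g * hodge K * v : Alt4 K ≃ₗ[K] Alt4 K) : Alt4 K →ₗ[K] Alt4 K) =
          - LinearMap.det (v : Alt4 K →ₗ[K] Alt4 K) := by
        have h1 := det_reflection_eq (r := ((g * hodge K : Alt4 K ≃ₗ[K] Alt4 K) :
          Alt4 K →ₗ[K] Alt4 K)) hx hgM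
        have h2 : ((g * hodge K * v : Alt4 K ≃ₗ[K] Alt4 K) : Alt4 K →ₗ[K] Alt4 K) =
          ((g * hodge K : Alt4 K ≃ₗ[K] Alt4 K) : Alt4 K →ₗ[K] Alt4 K) ∘ₗ v := rfl
        rw [h2, LinearMap.det_comp, h1, neg_one_mul]
      have hiso : ∀ M, pf K ((g * hodge K * v) M) = pf K M := by
        intro M
        rw [LinearEquiv.mul_apply, hgM, sub_eq_add_neg, QuadraticMap.map_add (pf K),
          QuadraticMap.map_neg, QuadraticMap.map_smul, QuadraticMap.polar_neg_right,
          QuadraticMap.polar_smul_right, hv]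
        simp only [smul_eq_mul]
        field_simp
        ring
      rcases ih _ hiso (by omega) with ⟨hpar, hmem, hd⟩ | ⟨hpar, hmem, hd⟩
      · refine Or.inr ⟨hpar.add_one, ?_, by rw [← hd, hdet, neg_neg]⟩
        -- Removing `g` leaves `star * v`, and conjugation by the star turns this into `v * star`.
        have h1 := hodge_mul_mul_hodge_mem (mul_mem (inv_mem hg) hmem)
        have h2 : hodge K * (g⁻¹ * (g * hodge K * v)) * hodge K =
            (hodge K * hodge K) * v * hodge K := by group
        rwa [h2, hodge_mul_hodge, one_mul] at h1
      · refine Or.inl ⟨hpar.add_one, ?_, by rw [← neg_neg (LinearMap.det _), ← hdet, hd, neg_neg]⟩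
        have h1 := hodge_mul_mul_hodge_mem (mul_mem (inv_mem hg) hmem)
        have h2 : hodge K * (g⁻¹ * (g * hodge K * v * hodge K)) * hodge K =
            (hodge K * hodge K) * v * (hodge K * hodge K) := by group
        rwa [h2, hodge_mul_hodge, one_mul, mul_one] at h1

theorem isometry_mem_congrGroup_iff {v : Alt4 K ≃ₗ[K] Alt4 K} (hv : ∀ M, pf K (v M) = pf K M) :
    v ∈ congrGroup K ↔ IsPositiveIsometry (pf K) v := by
  rcases isometry_parity _ v hv rfl with ⟨hpar, hmem, hd⟩ | ⟨hpar, hmem, hd⟩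
  · exact iff_of_true hmem ⟨hv, fun _ => hd, fun _ => hpar⟩
  · refine iff_of_false (fun h => ?_) fun h => ?_
    · have := mul_mem (inv_mem h) hmem
      rw [inv_mul_cancel_left] at this
      exact hodge_notMem_congrGroup this
    · by_cases h2 : (2 : K) = 0
      · exact Nat.not_even_iff_odd.2 hpar (h.2.2 h2)
      · have h3 := h.2.1 h2
        rw [hd] at h3
        exact h2 (by linear_combination -h3)

end Isometries

/-! ### Transport of positive isometries -/

section Transport

variable {F V W : Type*} [Field F] [AddCommGroup V] [Module F V] [AddCommGroup W] [Module F W]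

theorem IsPositiveIsometry.conj {Q : QuadraticForm F V} {R : QuadraticForm F W}
    {v : V ≃ₗ[F] V} (hv : IsPositiveIsometry Q v) (e : V ≃ₗ[F] W) (he : ∀ x, R (e x) = Q x) :
    IsPositiveIsometry R (e.symm ≪≫ₗ v ≪≫ₗ e) := by
  refine ⟨fun x => ?_, fun h => ?_, fun h => ?_⟩
  · rw [LinearEquiv.trans_apply, LinearEquiv.trans_apply, he, hv.1, ← he, e.apply_symm_apply]
  · rw [← hv.2.1 h]
    exact LinearMap.det_conj (v : V →ₗ[F] V) e
  · have h1 : LinearMap.range (((e.symm ≪≫ₗ v ≪≫ₗ e : W ≃ₗ[F] W) : W →ₗ[F] W) - LinearMap.id) =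
        (LinearMap.range ((v : V →ₗ[F] V) - LinearMap.id)).map (e : V →ₗ[F] W) := by
      have h2 : ((e.symm ≪≫ₗ v ≪≫ₗ e : W ≃ₗ[F] W) : W →ₗ[F] W) - LinearMap.id =
          ((e : V →ₗ[F] W) ∘ₗ ((v : V →ₗ[F] V) - LinearMap.id)) ∘ₗ (e.symm : W →ₗ[F] V) := by
        ext x
        simp
      rw [h2, LinearMap.range_comp_of_range_eq_top _ e.symm.range, LinearMap.range_comp]
    rw [h1, LinearEquiv.finrank_map_eq]
    exact hv.2.2 h

end Transport

/-! ### Extension of scalars of alternating matrices -/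

section BaseChange

universe u

variable {K : Type u} [Field K] (L : Type u) [Field L] [Algebra K L]

/-- Extension of scalars of alternating matrices. -/
def altMap (M : Alt4 K) : Alt4 L :=
  ⟨M.1.map (algebraMap K L), by
    rw [← Matrix.transpose_map, alt_transpose_eq_neg]
    ext i j
    simp, fun i => by rw [Matrix.map_apply, alt_diag_eq_zero, map_zero]⟩

/-- `L ⊗ A₄(K)` is identified with `A₄(L)`. -/
def tensorAltEquiv (K : Type u) [Field K] (L : Type u) [Field L] [Algebra K L] :
    (L ⊗[K] Alt4 K) ≃ₗ[L] Alt4 L :=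
  (altEquiv K).baseChange K L _ _ ≪≫ₗ TensorProduct.piScalarRight K L L (Fin 6) ≪≫ₗ
    (altEquiv L).symm

theorem tensorAltEquiv_one_tmul (M : Alt4 K) :
    tensorAltEquiv K L ((1 : L) ⊗ₜ[K] M) = altMap L M := by
  rw [tensorAltEquiv, LinearEquiv.trans_apply, LinearEquiv.trans_apply,
    LinearEquiv.symm_apply_eq]
  change TensorProduct.piScalarRight K L L (Fin 6) ((1 : L) ⊗ₜ[K] (altEquiv K M)) = _
  rw [TensorProduct.piScalarRight_apply, TensorProduct.piScalarRightHom_tmul]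
  ext i
  rw [Algebra.smul_def, mul_one]
  fin_cases i <;> rfl

theorem pf_altMap (M : Alt4 K) : pf L (altMap L M) = algebraMap K L (pf K M) := by
  simp [pf_apply, altMap]

theorem pf_tensorAltEquiv (z : L ⊗[K] Alt4 K) :
    pf L (tensorAltEquiv K L z) = extendScalars L (pf K) z := by
  have h := eq_extendScalars L (pf K) ((pf L).comp (tensorAltEquiv K L).toLinearMap) fun x => by
    rw [QuadraticMap.comp_apply, LinearEquiv.coe_coe, tensorAltEquiv_one_tmul, pf_altMap]
  rw [← h]
  rfl

variable {L}

theorem tensor_linearMap_ext {V E : Type*} [AddCommGroup V] [Module K V] [AddCommGroup E]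
    [Module L E] {f g : (L ⊗[K] V) →ₗ[L] E} (h : ∀ x, f (1 ⊗ₜ[K] x) = g (1 ⊗ₜ[K] x)) :
    f = g := by
  refine LinearMap.ext fun z => ?_
  induction z with
  | zero => simp
  | add z w hz hw => rw [map_add, map_add, hz, hw]
  | tmul a x =>
    have hx : a ⊗ₜ[K] x = a • ((1 : L) ⊗ₜ[K] x) := by simp [TensorProduct.smul_tmul']
    rw [hx, map_smul, map_smul, h]

/-- The matrices with entries in `K` span `A₄(L)` over `L`. -/
theorem alt_linearMap_ext {E : Type*} [AddCommGroup E] [Module L E] {f g : Alt4 L →ₗ[L] E}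
    (h : ∀ M : Alt4 K, f (altMap L M) = g (altMap L M)) : f = g := by
  have h1 : f ∘ₗ (tensorAltEquiv K L).toLinearMap = g ∘ₗ (tensorAltEquiv K L).toLinearMap :=
    tensor_linearMap_ext fun x => by
      rw [LinearMap.comp_apply, LinearMap.comp_apply, LinearEquiv.coe_coe,
        tensorAltEquiv_one_tmul, h]
  refine LinearMap.ext fun z => ?_
  have := LinearMap.congr_fun h1 ((tensorAltEquiv K L).symm z)
  simpa using this

theorem altMap_hodge (M : Alt4 K) : altMap L (hodge K M) = hodge L (altMap L M) := by
  apply alt_ext <;> simp [altMap, hodge_apply, altOf]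

theorem altMap_congrMap (c : Kˣ) (P : GL (Fin 4) K) (M : Alt4 K) :
    altMap L (congrMap c P M) = congrMap (Units.map (algebraMap K L) c)
      (Matrix.GeneralLinearGroup.map (algebraMap K L) P) (altMap L M) := by
  apply Subtype.ext
  ext i j
  simp [altMap, congrMap_apply, Matrix.mul_apply, Fin.sum_univ_four]

/-- Replaces the tensor product by matrices over the closure, where the results on isometries of the
pfaffian apply. -/
theorem isPositiveSimilarity_pf_iff (s : Alt4 K ≃ₗ[K] Alt4 K) :
    IsPositiveSimilarity (pf K) s ↔ IsSimilarity (pf K) s ∧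
      ∃ (μ : AlgebraicClosure K) (w : Alt4 (AlgebraicClosure K) ≃ₗ[AlgebraicClosure K]
        Alt4 (AlgebraicClosure K)), μ ≠ 0 ∧ IsPositiveIsometry (pf (AlgebraicClosure K)) w ∧
        ∀ M : Alt4 K, altMap (AlgebraicClosure K) (s M) =
          μ • w (altMap (AlgebraicClosure K) M) := by
  refine and_congr_right fun _ => ⟨?_, ?_⟩
  · rintro ⟨μ, v, hμ, hv, h⟩
    refine ⟨μ, _, hμ, hv.conj (tensorAltEquiv K _) (pf_tensorAltEquiv _), fun M => ?_⟩
    have h1 := congrArg (tensorAltEquiv K _) (h (1 ⊗ₜ[K] M))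
    rw [LinearMap.baseChange_tmul, LinearEquiv.coe_coe, tensorAltEquiv_one_tmul, map_smul] at h1
    rw [h1, LinearEquiv.trans_apply, LinearEquiv.trans_apply, ← tensorAltEquiv_one_tmul,
      LinearEquiv.symm_apply_apply]
  · rintro ⟨μ, w, hμ, hw, h⟩
    let e := tensorAltEquiv K (AlgebraicClosure K)
    let v := e.symm.symm ≪≫ₗ w ≪≫ₗ e.symm
    refine ⟨μ, v, hμ, hw.conj e.symm (fun x => ?_), fun z => ?_⟩
    · rw [← pf_tensorAltEquiv, LinearEquiv.apply_symm_apply]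
    · refine LinearMap.congr_fun (g := μ • v.toLinearMap)
        (tensor_linearMap_ext fun M => e.injective ?_) z
      rw [LinearMap.baseChange_tmul, LinearEquiv.coe_coe, tensorAltEquiv_one_tmul, h,
        LinearMap.smul_apply, map_smul, LinearEquiv.coe_coe, LinearEquiv.trans_apply,
        LinearEquiv.trans_apply, LinearEquiv.apply_symm_apply, LinearEquiv.symm_symm,
        tensorAltEquiv_one_tmul]

end BaseChange

/-! ### Positive similarities of the pfaffian -/

section Main

universe u

variable {K : Type u} [Field K]

theorem isPositiveSimilarity_of_mem_congrGroup {s : Alt4 K ≃ₗ[K] Alt4 K}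
    (hs : s ∈ congrGroup K) : IsPositiveSimilarity (pf K) s := by
  obtain ⟨c, P, rfl⟩ := hs
  have hm : (c : K) ^ 2 * P.1.det ≠ 0 :=
    mul_ne_zero (pow_ne_zero 2 c.ne_zero) (Matrix.GeneralLinearGroup.det P).ne_zero
  -- Dividing by a square root `μ` of the multiplier gives an isometry that is still a congruence
  -- over the closure.
  obtain ⟨μ, hμ⟩ := IsAlgClosed.exists_pow_nat_eq
    (algebraMap K (AlgebraicClosure K) ((c : K) ^ 2 * P.1.det)) two_pos
  have hμ0 : μ ≠ 0 := by
    rintro rfl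
    rw [zero_pow two_ne_zero, eq_comm, map_eq_zero] at hμ
    exact hm hμ
  set φ := algebraMap K (AlgebraicClosure K)
  let w := congrMap ((Units.mk0 μ hμ0)⁻¹ * Units.map φ c) (Matrix.GeneralLinearGroup.map φ P)
  rw [isPositiveSimilarity_pf_iff]
  refine ⟨⟨_, hm, pf_congrMap c P⟩, μ, w, hμ0,
    (isometry_mem_congrGroup_iff fun M => ?_).1 (congrMap_mem_congrGroup _ _), fun M => ?_⟩
  · have hdet : (Matrix.GeneralLinearGroup.map φ P).1.det = φ P.1.det := (φ.map_det P.1).symm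
    have h1 : (((Units.mk0 μ hμ0)⁻¹ * Units.map φ c : (AlgebraicClosure K)ˣ) :
        AlgebraicClosure K) ^ 2 * φ P.1.det = 1 := by
      rw [map_mul, map_pow] at hμ
      have : (((Units.mk0 μ hμ0)⁻¹ * Units.map φ c : (AlgebraicClosure K)ˣ) :
        AlgebraicClosure K) = μ⁻¹ * φ c := by simp
      rw [this, mul_pow, mul_assoc, ← hμ, ← mul_pow, inv_mul_cancel₀ hμ0, one_pow]
    rw [pf_congrMap, hdet, h1, one_mul]
  · apply Subtype.ext
    rw [altMap_congrMap, Submodule.coe_smul, congrMap_apply, congrMap_apply, smul_smul]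
    congr 1
    simp [hμ0, φ]

theorem mem_congrGroup_of_isPositiveSimilarity {s : Alt4 K ≃ₗ[K] Alt4 K}
    (hs : IsPositiveSimilarity (pf K) s) : s ∈ congrGroup K := by
  obtain ⟨⟨m, hm, hsm⟩, μ, w, hμ, hw, h⟩ := (isPositiveSimilarity_pf_iff s).1 hs
  -- Congruence by a matrix of determinant `m⁻¹` has multiplier `m⁻¹`, so the multiplier of `s` is
  -- cancelled over `K` without a square root.
  let D : GL (Fin 4) K := Matrix.GeneralLinearGroup.mkOfDetNeZero
    (Matrix.diagonal ![m⁻¹, 1, 1, 1]) (by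
      simp [Matrix.det_diagonal, Fin.prod_univ_four, hm])
  have hD : D.1.det = m⁻¹ := by
    change (Matrix.diagonal ![m⁻¹, 1, 1, 1]).det = _
    simp [Matrix.det_diagonal, Fin.prod_univ_four]
  have hDmem := congrMap_mem_congrGroup 1 D
  have hiso : ∀ M, pf K ((congrMap 1 D * s) M) = pf K M := fun M => by
    rw [LinearEquiv.mul_apply, pf_congrMap, hD, hsm, Units.val_one, one_pow, one_mul,
      inv_mul_cancel_left₀ hm]
  rcases isometry_parity _ _ hiso rfl with ⟨-, hmem, -⟩ | ⟨-, hmem, -⟩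
  · exact (Subgroup.mul_mem_cancel_left _ hDmem).1 hmem
  · rw [mul_assoc, Subgroup.mul_mem_cancel_left _ hDmem] at hmem
    obtain ⟨c, P, hcP⟩ := hmem
    have hsM : ∀ M, s M = congrMap c P (hodge K M) := fun M => by
      rw [← hcP, LinearEquiv.mul_apply, hodge_hodge]
    set φ := algebraMap K (AlgebraicClosure K)
    -- In the star coset, `w` would be a congruence times the star over the closure; being positive,
    -- it is also a congruence, so the star would be one too.
    have hw' : w = congrMap ((Units.mk0 μ hμ)⁻¹ * Units.map φ c)
        (Matrix.GeneralLinearGroup.map φ P) * hodge (AlgebraicClosure K) := by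
      refine LinearEquiv.toLinearMap_injective (alt_linearMap_ext (K := K) fun M => ?_)
      have h1 := h M
      rw [hsM, altMap_congrMap, altMap_hodge, ← inv_smul_eq_iff₀ hμ] at h1
      rw [LinearEquiv.coe_coe, ← h1, LinearEquiv.coe_coe, LinearEquiv.mul_apply]
      apply Subtype.ext
      rw [Submodule.coe_smul, congrMap_apply, congrMap_apply, smul_smul]
      congr 1
    have hwmem := (isometry_mem_congrGroup_iff hw.1).2 hw
    rw [hw', Subgroup.mul_mem_cancel_left _ (congrMap_mem_congrGroup _ _)] at hwmem
    exact absurd hwmem hodge_notMem_congrGroup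

theorem setOf_isPositiveSimilarity_eq :
    {s | IsPositiveSimilarity (pf K) s} = (congrGroup K : Set (Alt4 K ≃ₗ[K] Alt4 K)) :=
  Set.ext fun _ => ⟨mem_congrGroup_of_isPositiveSimilarity, isPositiveSimilarity_of_mem_congrGroup⟩

end Main

end PfaffianSimilarity

end

theorem mainTheorem10 {K : Type*} [Field K] :
    (∃ G : Subgroup (PfaffianSimilarity.Alt4 K ≃ₗ[K] PfaffianSimilarity.Alt4 K),
      (G : Set (PfaffianSimilarity.Alt4 K ≃ₗ[K] PfaffianSimilarity.Alt4 K)) =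
        {s | PfaffianSimilarity.IsPositiveSimilarity (PfaffianSimilarity.pf K) s}) ∧
    {s | PfaffianSimilarity.IsPositiveSimilarity (PfaffianSimilarity.pf K) s} =
      {s | ∃ (c : Kˣ) (P : GL (Fin 4) K), s = PfaffianSimilarity.congrMap c P} :=
  ⟨⟨PfaffianSimilarity.congrGroup K, PfaffianSimilarity.setOf_isPositiveSimilarity_eq.symm⟩,
    PfaffianSimilarity.setOf_isPositiveSimilarity_eq⟩
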